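/- Conventions. An order unit space is an archimedean partially ordered real vector space $A$ with a distinguished order unit $1$; its order unit norm is $\|a\|_1=\inf\{\lambda\ge 0:\ -\lambda 1\le a\le \lambda 1\}$, and $E=\{e\in A:\ 0\le e\le 1\}$. A compression with focus $p\in E$ is a positive linear map $J:A\to A$ with $J(1)=p$ such that for all $e\in E$: $e\le p$ implies $J(e)=e$, and $J(e)=0$ implies $e\le 1-p$. A compression base is a family $(J_p)_{p\in P}$ of compressions indexed by their own foci, where $P\subseteq E$ contains $1$, is closed under $p\mapsto 1-p$ and under sums $p+q\le 1$, is normal (if $d,e,f\in E$, $d+e+f\le 1$ and $d+e,\,d+f\in P$, then $d\in P$), and $J_{p+r}\circ J_{q+r}=J_r$ whenever $p,q,r\in P$ and $p+q+r\le 1$. An element $a\in A$ commutes with $p\in P$ if $a=J_p(a)+J_{1-p}(a)$. For $S\subseteq A$ let $PC(S)$ be the set of all $p\in P$ that commute with every element of $S$, and for $a\in A$ let $P(a)=PC(PC(\{a\})\cup\{a\})$. The base is spectral if (a) for every $e\in E$ there is $p\in P$ such that, for all $q\in P$, $e\le q\iff p\le q$, and (b) for every $a\in A$ there is $p\in P(a)$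 with $J_{1-p}(a)\le 0\le J_p(a)$. $A$ is spectral if it has a spectral compression base. The base satisfies the JB condition if $$J_p(q)+J_{1-p}(1-q)=J_q(p)+J_{1-q}(1-p)\qquad\text{for all } p,q\in P.$$ $A$ is a JB-algebra if it is complete in $\|\cdot\|=\|\cdot\|_1$ and has a commutative bilinear product $\circ$ with identity $1$ such that, writing $a^2=a\circ a$, for all $a,b\in A$: $(a^2\circ b)\circ a=a^2\circ(b\circ a)$, $\|a\circ b\|\le\|a\|\|b\|$, $\|a^2\|=\|a\|^2$ and $\|a^2\|\le\|a^2+b^2\|$. It is a JBW-algebra if, moreover, it is isometrically isomorphic to the dual of a Banach space. Theorem 5.4 (generalized spin factors). Let $X$ be a real Banach space with dual $X^*$, and let $A=\mathbb R\times X^*$ be the order unit space with positive cone $A^+=\{(\alpha,y):\ \|y\|\le\alpha\}$ and order unit $(1,0)$. The following are equivalent: 1. $A$ is spectral and satisfies the JB condition, that is, $A$ has a spectral compression base that satisfies the JB condition; 1'. $A$ is spectral, and every spectral compression base of $A$ satisfies the JB condition; 2. $A$ is a JB-algebra; 3. $A$ is a spin factor, that is, $X$ is a Hilbert space (its norm comes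 from an inner product; any dimension is allowed); 4. $A$ is a JBW-algebra. -/

import Mathlib

universe u

/-- An order unit space: an archimedean partially ordered real vector space with a distinguished
order unit. -/
class OrderUnitSpace (A : Type u) [AddCommGroup A] [Module ℝ A] [PartialOrder A] where
  /-- the distinguished order unit -/
  unit : A
  add_le_add_left' : ∀ a b c : A, a ≤ b → c + a ≤ c + b
  smul_nonneg' : ∀ (r : ℝ) (a : A), 0 ≤ r → 0 ≤ a → 0 ≤ r • a
  unit_nonneg : 0 ≤ unit
  exists_le_smul_unit : ∀ a : A, ∃ r : ℝ, 0 ≤ r ∧ a ≤ r • unit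
  archimedean : ∀ a b : A, (∀ n : ℕ, (n : ℝ) • a ≤ b) → a ≤ 0

namespace OrderUnitSpace

section

variable {A : Type u} [AddCommGroup A] [Module ℝ A] [PartialOrder A] [OrderUnitSpace A]

/-! ### The order unit norm -/

/-- The order unit norm `inf {r ≥ 0 | -r • 1 ≤ a ≤ r • 1}`. -/
noncomputable def orderUnitNorm (a : A) : ℝ :=
  sInf {r : ℝ | 0 ≤ r ∧ -(r • (unit : A)) ≤ a ∧ a ≤ r • (unit : A)}

theorem nonneg_sub {a b : A} (h : a ≤ b) : 0 ≤ b - a := by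
  have := add_le_add_left' a b (-a) h
  simpa [neg_add_eq_sub] using this

theorem le_of_nonneg_sub {a b : A} (h : 0 ≤ b - a) : a ≤ b := by
  have := add_le_add_left' 0 (b - a) a h
  simpa using this

theorem add_le_add' {a b c d : A} (h : a ≤ b) (h' : c ≤ d) : a + c ≤ b + d := by
  have h1 := add_le_add_left' c d a h'
  have h2 := add_le_add_left' a b d h
  rw [add_comm d a, add_comm d b] at h2
  exact h1.trans h2

theorem neg_le_neg'' {a b : A} (h : a ≤ b) : -b ≤ -a := by
  apply le_of_nonneg_sub
  have := nonneg_sub h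
  rwa [neg_sub_neg]

theorem smul_le_smul' {a b : A} {r : ℝ} (hr : 0 ≤ r) (h : a ≤ b) : r • a ≤ r • b := by
  apply le_of_nonneg_sub
  rw [← smul_sub]
  exact smul_nonneg' _ _ hr (nonneg_sub h)

theorem smul_unit_mono {r s : ℝ} (h : r ≤ s) : r • (unit : A) ≤ s • (unit : A) := by
  apply le_of_nonneg_sub
  rw [← sub_smul]
  exact smul_nonneg' _ _ (sub_nonneg.2 h) unit_nonneg

theorem exists_bound (a : A) :
    ∃ r : ℝ, 0 ≤ r ∧ -(r • (unit : A)) ≤ a ∧ a ≤ r • (unit : A) := by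
  obtain ⟨r, hr, h⟩ := exists_le_smul_unit a
  obtain ⟨s, hs, h'⟩ := exists_le_smul_unit (-a)
  refine ⟨max r s, le_max_of_le_left hr, ?_, h.trans (smul_unit_mono (le_max_left r s))⟩
  have := neg_le_neg'' (h'.trans (smul_unit_mono (le_max_right r s)))
  rwa [neg_neg] at this

theorem orderUnitNorm_nonneg (a : A) : 0 ≤ orderUnitNorm a :=
  Real.sInf_nonneg fun _ hr => hr.1

theorem orderUnitNorm_le {a : A} {r : ℝ} (hr : 0 ≤ r) (h : -(r • (unit : A)) ≤ a)
    (h' : a ≤ r • (unit : A)) : orderUnitNorm a ≤ r :=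
  csInf_le ⟨0, fun _ hr => hr.1⟩ ⟨hr, h, h'⟩

theorem bound_of_orderUnitNorm_lt {a : A} {r : ℝ} (h : orderUnitNorm a < r) :
    -(r • (unit : A)) ≤ a ∧ a ≤ r • (unit : A) := by
  obtain ⟨s, ⟨_, h1, h2⟩, hs⟩ := exists_lt_of_csInf_lt (exists_bound a) h
  have := smul_unit_mono (A := A) hs.le
  exact ⟨(neg_le_neg'' this).trans h1, h2.trans this⟩

theorem le_zero_of_forall_le {a : A} (h : ∀ r : ℝ, 0 < r → a ≤ r • (unit : A)) : a ≤ 0 := by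
  apply archimedean a unit
  intro n
  rcases Nat.eq_zero_or_pos n with rfl | hn
  · simpa using (unit_nonneg : (0 : A) ≤ unit)
  · have hn' : (0 : ℝ) < n := by exact_mod_cast hn
    have := smul_le_smul' hn'.le (h (n : ℝ)⁻¹ (inv_pos.2 hn'))
    rwa [smul_smul, mul_inv_cancel₀ hn'.ne', one_smul] at this

theorem orderUnitNorm_neg_le (a : A) : orderUnitNorm (-a) ≤ orderUnitNorm a := by
  refine le_of_forall_gt fun r hr => ?_
  obtain ⟨s, hs, hsr⟩ := exists_between hr
  obtain ⟨h1, h2⟩ := bound_of_orderUnitNorm_lt hs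
  refine (orderUnitNorm_le ((orderUnitNorm_nonneg a).trans hs.le) (neg_le_neg'' h2) ?_).trans_lt hsr
  have := neg_le_neg'' h1
  rwa [neg_neg] at this

theorem orderUnitNorm_smul_le (t : ℝ) (a : A) :
    orderUnitNorm (t • a) ≤ |t| * orderUnitNorm a := by
  wlog ht : 0 ≤ t generalizing t a
  · have := this (-t) (-a) (by linarith [not_le.1 ht])
    rw [neg_smul_neg, abs_neg] at this
    exact this.trans (mul_le_mul_of_nonneg_left (orderUnitNorm_neg_le a) (abs_nonneg t))
  rw [abs_of_nonneg ht]
  refine le_of_forall_pos_le_add fun ε hε => ?_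
  have hδ : 0 < ε / (t + 1) := by positivity
  obtain ⟨h1, h2⟩ := bound_of_orderUnitNorm_lt (lt_add_of_pos_right (orderUnitNorm a) hδ)
  have h0 := orderUnitNorm_nonneg a
  refine (orderUnitNorm_le (r := t * (orderUnitNorm a + ε / (t + 1))) (by positivity) ?_ ?_).trans ?_
  · rw [mul_smul, ← smul_neg]
    exact smul_le_smul' ht h1
  · rw [mul_smul]
    exact smul_le_smul' ht h2
  · rw [mul_add]
    have : t * (ε / (t + 1)) ≤ ε := by
      rw [mul_div_assoc', div_le_iff₀ (by positivity)]
      nlinarith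
    linarith

variable (A) in
/-- The order unit norm as a norm on the additive group of the space. -/
noncomputable def addGroupNorm : AddGroupNorm A where
  toFun := orderUnitNorm
  map_zero' := le_antisymm
    (orderUnitNorm_le le_rfl (by simp) (by simp)) (orderUnitNorm_nonneg 0)
  add_le' a b := by
    refine le_of_forall_pos_le_add fun ε hε => ?_
    obtain ⟨h1, h2⟩ := bound_of_orderUnitNorm_lt (lt_add_of_pos_right (orderUnitNorm a) (half_pos hε))
    obtain ⟨h3, h4⟩ := bound_of_orderUnitNorm_lt (lt_add_of_pos_right (orderUnitNorm b) (half_pos hε))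
    have ha := orderUnitNorm_nonneg a
    have hb := orderUnitNorm_nonneg b
    have e : orderUnitNorm a + orderUnitNorm b + ε
        = (orderUnitNorm a + ε / 2) + (orderUnitNorm b + ε / 2) := by ring
    rw [e]
    refine orderUnitNorm_le (by positivity) ?_ ?_
    · rw [add_smul, neg_add]
      exact add_le_add' h1 h3
    · rw [add_smul]
      exact add_le_add' h2 h4
  neg' a := le_antisymm (orderUnitNorm_neg_le a)
    (by simpa using orderUnitNorm_neg_le (-a))
  eq_zero_of_map_eq_zero' a h := by
    have h' : ∀ r : ℝ, 0 < r → -(r • (unit : A)) ≤ a ∧ a ≤ r • (unit : A) := fun r hr =>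
      bound_of_orderUnitNorm_lt (h.trans_lt hr)
    refine le_antisymm (le_zero_of_forall_le fun r hr => (h' r hr).2) ?_
    have : -a ≤ 0 := le_zero_of_forall_le fun r hr => by
      have := neg_le_neg'' (h' r hr).1
      rwa [neg_neg] at this
    have := neg_le_neg'' this
    simpa using this

/-! ### Compressions and compression bases -/

/-- A compression with focus `p`: a positive linear map `J` with `J 1 = p ∈ [0, 1]` such that, for
all effects `e`, `e ≤ p` implies `J e = e`, and `J e = 0` implies `e ≤ 1 - p`. -/
structure IsCompression (p : A) (J : A →ₗ[ℝ] A) : Prop where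
  positive : ∀ a, 0 ≤ a → 0 ≤ J a
  map_unit : J unit = p
  focus_mem : p ∈ Set.Icc (0 : A) unit
  map_eq_self : ∀ e ∈ Set.Icc (0 : A) unit, e ≤ p → J e = e
  le_of_map_eq_zero : ∀ e ∈ Set.Icc (0 : A) unit, J e = 0 → e ≤ unit - p

variable (A) in
/-- A compression base: a family of compressions indexed by their own foci, where the set `P` of
foci is a normal subalgebra of the effect algebra `[0, 1]`, and `J_{p+r} ∘ J_{q+r} = J_r` whenever
`p, q, r ∈ P` and `p + q + r ≤ 1`. (The values of `J` outside `P` play no role.) -/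
structure CompressionBase where
  /-- the set of projections -/
  P : Set A
  /-- the compression with a given focus -/
  J : A → A →ₗ[ℝ] A
  isCompression : ∀ p ∈ P, IsCompression p (J p)
  unit_mem : unit ∈ P
  compl_mem : ∀ p ∈ P, unit - p ∈ P
  add_mem : ∀ p ∈ P, ∀ q ∈ P, p + q ≤ unit → p + q ∈ P
  normal : ∀ d ∈ Set.Icc (0 : A) unit, ∀ e ∈ Set.Icc (0 : A) unit, ∀ f ∈ Set.Icc (0 : A) unit,
    d + e + f ≤ unit → d + e ∈ P → d + f ∈ P → d ∈ P
  comp : ∀ p ∈ P, ∀ q ∈ P, ∀ r ∈ P, p + q + r ≤ unit → J (p + r) ∘ₗ J (q + r) = J r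

namespace CompressionBase

variable (B : CompressionBase A)

/-- `a` commutes with the projection `p`, i.e. `a ∈ C(p)`. -/
def Commutes (a p : A) : Prop := a = B.J p a + B.J (unit - p) a

/-- `PC(S)`: the set of projections commuting with all elements of `S`. -/
def PC (S : Set A) : Set A := {p | p ∈ B.P ∧ ∀ a ∈ S, B.Commutes a p}

/-- The P-bicommutant `P(a) = PC(PC(a) ∪ {a})`. -/
def bicommutant (a : A) : Set A := B.PC (B.PC {a} ∪ {a})

/-- Every effect has a projection cover. -/
def HasProjectionCover : Prop :=
  ∀ e ∈ Set.Icc (0 : A) unit, ∃ p ∈ B.P, ∀ q ∈ B.P, e ≤ q ↔ p ≤ q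

/-- The comparability property. -/
def HasComparability : Prop :=
  ∀ a : A, ∃ p ∈ B.bicommutant a, B.J (unit - p) a ≤ 0 ∧ 0 ≤ B.J p a

/-- A compression base is spectral if it has both the projection cover and the comparability
property. -/
def IsSpectral : Prop := B.HasProjectionCover ∧ B.HasComparability

/-- The JB condition: `J_p(q) + J_{1-p}(1-q) = J_q(p) + J_{1-q}(1-p)` for all projections. -/
def JBCondition : Prop :=
  ∀ p ∈ B.P, ∀ q ∈ B.P,
    B.J p q + B.J (unit - p) (unit - q) = B.J q p + B.J (unit - q) (unit - p)

end CompressionBase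

end

end OrderUnitSpace

/-! ### JB-algebras and JBW-algebras -/

/-- The bilinear product `mul` on the normed space `A` is a Jordan product with identity `one`
which satisfies the norm axioms of a JB-algebra. -/
structure IsJBProduct {A : Type u} [NormedAddCommGroup A] [NormedSpace ℝ A]
    (one : A) (mul : A →ₗ[ℝ] A →ₗ[ℝ] A) : Prop where
  comm : ∀ a b, mul a b = mul b a
  jordan : ∀ a b, mul (mul (mul a a) b) a = mul (mul a a) (mul b a)
  one_mul : ∀ a, mul one a = a
  norm_mul_le : ∀ a b, ‖mul a b‖ ≤ ‖a‖ * ‖b‖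
  norm_sq : ∀ a, ‖mul a a‖ = ‖a‖ ^ 2
  norm_sq_le : ∀ a b, ‖mul a a‖ ≤ ‖mul a a + mul b b‖

/-- `A`, with its given norm, is complete and carries a Jordan product with identity `one` which
makes it a JB-algebra. -/
def IsJBAlgebra (A : Type u) [NormedAddCommGroup A] [NormedSpace ℝ A] (one : A) : Prop :=
  CompleteSpace A ∧ ∃ mul : A →ₗ[ℝ] A →ₗ[ℝ] A, IsJBProduct one mul

/-- A JBW-algebra: a JB-algebra that is (isometrically isomorphic to) the dual of a Banach
space. -/
def IsJBWAlgebra (A : Type u) [NormedAddCommGroup A] [NormedSpace ℝ A] (one : A) : Prop :=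
  IsJBAlgebra A one ∧
    ∃ (Y : Type u) (_ : NormedAddCommGroup Y) (_ : NormedSpace ℝ Y) (_ : CompleteSpace Y),
      Nonempty (A ≃ₗᵢ[ℝ] StrongDual ℝ Y)

/-! ### Generalized spin factors -/

section

variable (X : Type u) [NormedAddCommGroup X] [NormedSpace ℝ X]

/-- The vector space `ℝ × X*` underlying the generalized spin factor of `X`. It is a type synonym,
so that it carries neither the componentwise order nor the supremum norm of the product. -/
def GenSpinFactor : Type u := ℝ × StrongDual ℝ X

namespace GenSpinFactor

noncomputable instance : AddCommGroup (GenSpinFactor X) :=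
  inferInstanceAs (AddCommGroup (ℝ × StrongDual ℝ X))

noncomputable instance : Module ℝ (GenSpinFactor X) :=
  inferInstanceAs (Module ℝ (ℝ × StrongDual ℝ X))

/-- The order given by the positive cone `{(α, y) | ‖y‖ ≤ α}`: `a ≤ b` means that `b - a` lies in
the cone. -/
instance : PartialOrder (GenSpinFactor X) where
  le a b := ‖(b - a).2‖ ≤ (b - a).1
  le_refl a := by
    rw [sub_self]
    exact (norm_zero (E := StrongDual ℝ X)).le
  le_trans a b c h h' := by
    have e : c - a = (c - b) + (b - a) := (sub_add_sub_cancel c b a).symm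
    change ‖(c - a).2‖ ≤ (c - a).1
    rw [e]
    exact (norm_add_le (E := StrongDual ℝ X) _ _).trans (add_le_add h' h)
  le_antisymm a b h h' := by
    have e : a - b = -(b - a) := (neg_sub b a).symm
    change ‖(a - b).2‖ ≤ (a - b).1 at h'
    change ‖(b - a).2‖ ≤ (b - a).1 at h
    rw [e] at h'
    have h1 : ‖(b - a).2‖ ≤ -(b - a).1 := by
      have := norm_neg (E := StrongDual ℝ X) (b - a).2
      exact this.ge.trans h'
    have h0 : 0 ≤ ‖(b - a).2‖ := norm_nonneg (E := StrongDual ℝ X) _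
    have h2 : (b - a).2 = 0 := norm_le_zero_iff.1 (by linarith)
    have h3 : (b - a).1 = 0 := by linarith
    have : b - a = 0 := Prod.ext h3 h2
    exact (sub_eq_zero.1 this).symm

variable {X} in
theorem le_def (a b : GenSpinFactor X) : a ≤ b ↔ ‖b.2 - a.2‖ ≤ b.1 - a.1 := Iff.rfl

variable {X} in
theorem nonneg_iff (a : GenSpinFactor X) : 0 ≤ a ↔ ‖a.2‖ ≤ a.1 := by
  have : a - 0 = a := sub_zero a
  change ‖(a - 0).2‖ ≤ (a - 0).1 ↔ _
  rw [this]

/-- `ℝ × X*` is an order unit space with order unit `(1, 0)`. -/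
noncomputable instance : OrderUnitSpace (GenSpinFactor X) where
  unit := ((1, 0) : ℝ × StrongDual ℝ X)
  add_le_add_left' a b c h := by
    change ‖((c + b) - (c + a)).2‖ ≤ ((c + b) - (c + a)).1
    rw [add_sub_add_left_eq_sub]
    exact h
  smul_nonneg' r a hr h := by
    rw [nonneg_iff] at h ⊢
    change ‖r • a.2‖ ≤ r * a.1
    rw [norm_smul, Real.norm_of_nonneg hr]
    exact mul_le_mul_of_nonneg_left h hr
  unit_nonneg := by
    refine (nonneg_iff _).2 ?_
    exact (norm_zero (E := StrongDual ℝ X)).le.trans zero_le_one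
  exists_le_smul_unit a := by
    refine ⟨|a.1| + ‖a.2‖, by positivity, ?_⟩
    rw [le_def]
    change ‖(|a.1| + ‖a.2‖) • (0 : StrongDual ℝ X) - a.2‖ ≤ (|a.1| + ‖a.2‖) * 1 - a.1
    rw [smul_zero, zero_sub, norm_neg]
    linarith [le_abs_self a.1]
  archimedean a b h := by
    rw [le_def]
    change ‖(0 : StrongDual ℝ X) - a.2‖ ≤ 0 - a.1
    rw [zero_sub, zero_sub, norm_neg]
    by_contra! hlt
    obtain ⟨n, hn⟩ := exists_nat_gt ((‖b.2‖ + b.1) / (‖a.2‖ + a.1))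
    have hpos : 0 < ‖a.2‖ + a.1 := by linarith
    rw [div_lt_iff₀ hpos] at hn
    have h1 : ‖b.2 - (n : ℝ) • a.2‖ ≤ b.1 - n * a.1 := h n
    have h2 : ‖(n : ℝ) • a.2‖ ≤ ‖b.2‖ + ‖b.2 - (n : ℝ) • a.2‖ := norm_le_norm_add_norm_sub _ _
    rw [norm_smul, Real.norm_of_nonneg (Nat.cast_nonneg n)] at h2
    linarith

/-- The norm of a generalized spin factor is its order unit norm. -/
noncomputable instance : NormedAddCommGroup (GenSpinFactor X) :=
  (OrderUnitSpace.addGroupNorm (GenSpinFactor X)).toNormedAddCommGroup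

noncomputable instance : NormedSpace ℝ (GenSpinFactor X) where
  norm_smul_le t a := OrderUnitSpace.orderUnitNorm_smul_le t a

end GenSpinFactor

/-- The norm of `X` comes from an inner product (on the given real vector space). For a Banach
space `X` this says that `X` is a Hilbert space, i.e. that `ℝ × X*` is a spin factor. -/
def IsSpinFactor : Prop :=
  ∃ ip : InnerProductSpace ℝ X, ip.toNormedSpace = ‹NormedSpace ℝ X›

end

/-! Everything is decided at the rank one elements p = (1/2, y/2) with ‖y‖ = 1. An effect below both
a focus and its complement vanishes, so every focus is 0, 1 or of rank one (`focus_cases`). In a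
base with comparability, J_p has range in ℝp for rank one p in the base, and every rank one element
turns out to be a projection (`rankOne_mem`).

The scalar part of the JB condition at rank one projections then says that a function b(y, z) on X*,
linear in z and with b(y, y) = ‖y‖², is symmetric. This yields the parallelogram law in X*. For a JB
product the law comes instead from the quadratic map y ↦ (0, y)², whose scalar part is ‖y‖²
(`mul_inr_self`). In both cases it passes from X* to X (`parallelogram_of_dual`), and Jordan–von
Neumann applies.

Conversely, Riesz puts an inner product on X*. A functional of norm one attaining its norm at a unit
vector u is ⟨u, ·⟩ (`DualInner.eq_form`), so comparability leaves no freedom in the compressions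
(`J_eq_rankOneMap`) and the JB condition becomes an explicit symmetric formula. The same
compressions form a spectral base (`spinBase`), the spin product gives the JB structure, and the
predual is ℝ × X with the supremum norm. -/

namespace OrderUnitSpace

/-! ### General facts on compressions and compression bases. -/

section

variable {A : Type u} [AddCommGroup A] [Module ℝ A] [PartialOrder A] [OrderUnitSpace A]

instance : IsOrderedAddMonoid A where
  add_le_add_left a b h c := by
    rw [add_comm a c, add_comm b c]
    exact add_le_add_left' a b c h

theorem unit_mem_effects : (unit : A) ∈ Set.Icc (0 : A) unit := ⟨unit_nonneg, le_rfl⟩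

theorem zero_mem_effects : (0 : A) ∈ Set.Icc (0 : A) unit := ⟨le_rfl, unit_nonneg⟩

/-- A linear map on an order unit space is determined by its values on effects. -/
theorem linearMap_ext_effects {M : Type*} [AddCommGroup M] [Module ℝ M] {f g : A →ₗ[ℝ] M}
    (h : ∀ e ∈ Set.Icc (0 : A) unit, f e = g e) : f = g := by
  ext a
  obtain ⟨r, hr, h1, h2⟩ := exists_bound a
  have hu := h unit unit_mem_effects
  have hpos : (0 : ℝ) < 2 * r + 1 := by linarith
  have key := h ((2 * r + 1)⁻¹ • (a + r • unit)) ⟨?_, ?_⟩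
  · rw [map_smul, map_smul] at key
    have key := smul_right_injective M (inv_pos.2 hpos).ne' key
    simpa [hu] using key
  · apply smul_nonneg' _ _ (inv_pos.2 hpos).le
    rwa [← neg_le_iff_add_nonneg]
  · have h3 : a + r • (unit : A) ≤ (2 * r + 1) • (unit : A) :=
      calc a + r • (unit : A) ≤ r • unit + r • unit := add_le_add h2 le_rfl
        _ = (2 * r) • (unit : A) := by module
        _ ≤ _ := smul_unit_mono (by linarith)
    have := smul_le_smul' (inv_pos.2 hpos).le h3
    rwa [smul_smul, inv_mul_cancel₀ hpos.ne', one_smul] at this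

namespace IsCompression

variable {p : A} {J : A →ₗ[ℝ] A}

theorem map_focus (h : IsCompression p J) : J p = p := h.map_eq_self p h.focus_mem le_rfl

theorem map_compl (h : IsCompression p J) : J (unit - p) = 0 := by
  rw [map_sub, h.map_unit, h.map_focus, sub_self]

theorem mono (h : IsCompression p J) {a b : A} (hab : a ≤ b) : J a ≤ J b := by
  have := h.positive (b - a) (sub_nonneg.2 hab)
  rwa [map_sub, sub_nonneg] at this

theorem map_le (h : IsCompression p J) {a : A} (ha : a ≤ unit) : J a ≤ p := by
  simpa [h.map_unit] using h.mono ha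

/-- J fixes the effects below p and, being monotone, kills those below its null element 1 - p. -/
theorem sharp (h : IsCompression p J) {e : A} (h0 : 0 ≤ e) (h1 : e ≤ p) (h2 : e ≤ unit - p) :
    e = 0 := by
  have h3 := h.map_eq_self e ⟨h0, h1.trans h.focus_mem.2⟩ h1
  have h4 := h.mono h2
  rw [h3, h.map_compl] at h4
  exact le_antisymm h4 h0

end IsCompression

theorem IsCompression.eq_id {J : A →ₗ[ℝ] A} (h : IsCompression unit J) : J = LinearMap.id :=
  linearMap_ext_effects fun e he => h.map_eq_self e he he.2

theorem IsCompression.eq_zero {J : A →ₗ[ℝ] A} (h : IsCompression 0 J) : J = 0 :=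
  linearMap_ext_effects fun e he => le_antisymm (h.map_le he.2) (h.positive e he.1)

namespace CompressionBase

variable (B : CompressionBase A)

theorem zero_mem : (0 : A) ∈ B.P := by
  simpa using B.compl_mem unit B.unit_mem

theorem J_unit : B.J unit = LinearMap.id := (B.isCompression _ B.unit_mem).eq_id

theorem J_zero : B.J 0 = 0 := (B.isCompression _ B.zero_mem).eq_zero

variable {B}

/-- The JB condition holds automatically when one of the projections is trivial. -/
theorem jb_of_trivial {p q : A} (hp : p = 0 ∨ p = unit) (hq : q ∈ B.P) :
    B.J p q + B.J (unit - p) (unit - q) = B.J q p + B.J (unit - q) (unit - p) := by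
  have h1 := (B.isCompression q hq).map_unit
  have h2 := (B.isCompression _ (B.compl_mem q hq)).map_unit
  rcases hp with rfl | rfl
  · simp [B.J_unit, B.J_zero, h2]
  · simp [B.J_unit, B.J_zero, h1]

/-- If `p` commutes with `q`, then `J_q p` is a projection. -/
theorem Commutes.map_mem {p q : A} (hp : p ∈ B.P) (hq : q ∈ B.P) (h : B.Commutes p q) :
    B.J q p ∈ B.P := by
  have cq := B.isCompression q hq
  have cq' := B.isCompression _ (B.compl_mem q hq)
  have p0 := (B.isCompression p hp).focus_mem.1
  have p1 := (B.isCompression p hp).focus_mem.2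
  unfold Commutes at h
  have s0 := cq.positive p p0
  have s1 := cq.map_le p1
  have t0 := cq'.positive p p0
  have t1 := cq'.map_le p1
  -- Normality with d = J_q p, e = J_{1-q} p and f = q - J_q p: commutation gives d + e = p, and d +
  -- f = q.
  refine B.normal _ ⟨s0, s1.trans cq.focus_mem.2⟩ (B.J (unit - q) p)
    ⟨t0, t1.trans cq'.focus_mem.2⟩ (q - B.J q p)
    ⟨sub_nonneg.2 s1, (sub_le_self _ s0).trans cq.focus_mem.2⟩ ?_ ?_ ?_
  · have : B.J q p + B.J (unit - q) p + (q - B.J q p) = B.J (unit - q) p + q := by abel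
    rw [this]
    exact le_sub_iff_add_le.1 t1
  · rwa [← h]
  · simpa using hq

end CompressionBase

end

end OrderUnitSpace

/-! ### Coordinates, norm and possible foci in ℝ × X*. -/

namespace GenSpinFactor

open OrderUnitSpace

variable {X : Type u} [NormedAddCommGroup X] [NormedSpace ℝ X]

/-- The element `(α, y)` of a generalized spin factor. -/
def mk (α : ℝ) (y : StrongDual ℝ X) : GenSpinFactor X := (α, y)

@[simp] theorem mk_fst (α : ℝ) (y : StrongDual ℝ X) : (mk α y).1 = α := rfl
@[simp] theorem mk_snd (α : ℝ) (y : StrongDual ℝ X) : (mk α y).2 = y := rfl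
@[simp] theorem add_fst (a b : GenSpinFactor X) : (a + b).1 = a.1 + b.1 := rfl
@[simp] theorem add_snd (a b : GenSpinFactor X) : (a + b).2 = a.2 + b.2 := rfl
@[simp] theorem sub_fst (a b : GenSpinFactor X) : (a - b).1 = a.1 - b.1 := rfl
@[simp] theorem sub_snd (a b : GenSpinFactor X) : (a - b).2 = a.2 - b.2 := rfl
@[simp] theorem neg_fst (a : GenSpinFactor X) : (-a).1 = -a.1 := rfl
@[simp] theorem neg_snd (a : GenSpinFactor X) : (-a).2 = -a.2 := rfl
@[simp] theorem zero_fst : (0 : GenSpinFactor X).1 = 0 := rfl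
@[simp] theorem zero_snd : (0 : GenSpinFactor X).2 = 0 := rfl
@[simp] theorem smul_fst (r : ℝ) (a : GenSpinFactor X) : (r • a).1 = r * a.1 := rfl
@[simp] theorem smul_snd (r : ℝ) (a : GenSpinFactor X) : (r • a).2 = r • a.2 := rfl
@[simp] theorem unit_fst : (unit : GenSpinFactor X).1 = 1 := rfl
@[simp] theorem unit_snd : (unit : GenSpinFactor X).2 = 0 := rfl

theorem ext_iff' {a b : GenSpinFactor X} : a = b ↔ a.1 = b.1 ∧ a.2 = b.2 := Prod.ext_iff

theorem ext' {a b : GenSpinFactor X} (h1 : a.1 = b.1) (h2 : a.2 = b.2) : a = b := Prod.ext h1 h2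

/-- The projection onto the scalar part, as a linear map. -/
def fstL : GenSpinFactor X →ₗ[ℝ] ℝ where
  toFun a := a.1
  map_add' _ _ := rfl
  map_smul' _ _ := rfl

/-- The inclusion of the dual space, as a linear map. -/
def inr : StrongDual ℝ X →ₗ[ℝ] GenSpinFactor X where
  toFun y := mk 0 y
  map_add' _ _ := ext' (by simp) (by simp)
  map_smul' _ _ := ext' (by simp) (by simp)

@[simp] theorem fstL_apply (a : GenSpinFactor X) : fstL a = a.1 := rfl
@[simp] theorem inr_fst (y : StrongDual ℝ X) : (inr y).1 = 0 := rfl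
@[simp] theorem inr_snd (y : StrongDual ℝ X) : (inr y).2 = y := rfl

theorem eq_smul_unit_add (a : GenSpinFactor X) : a = a.1 • unit + inr a.2 :=
  ext' (by simp) (by simp)

/-- The order unit norm of a generalized spin factor is the `ℓ¹`-norm. -/
theorem norm_def (a : GenSpinFactor X) : ‖a‖ = |a.1| + ‖a.2‖ := by
  have hn : ‖a‖ = orderUnitNorm a := rfl
  rw [hn]
  apply le_antisymm
  · refine orderUnitNorm_le (by positivity) ?_ ?_
    · rw [le_def]
      simp
      linarith [neg_abs_le a.1]
    · rw [le_def]
      simp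
      linarith [le_abs_self a.1]
  · refine le_of_forall_gt fun r hr => ?_
    obtain ⟨s, hs, hsr⟩ := exists_between hr
    obtain ⟨h1, h2⟩ := bound_of_orderUnitNorm_lt hs
    rw [le_def] at h1 h2
    simp at h1 h2
    rcases abs_cases a.1 with h | h <;> linarith

theorem effect_fst {e : GenSpinFactor X} (he : 0 ≤ e) : 0 ≤ e.1 :=
  (norm_nonneg _).trans ((nonneg_iff e).1 he)

theorem eq_zero_of_nonneg {e : GenSpinFactor X} (he : 0 ≤ e) (h : e.1 = 0) : e = 0 := by
  rw [nonneg_iff, h] at he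
  exact ext' h (norm_le_zero_iff.1 he)

/-- The elements `(1/2, y/2)` with `‖y‖ = 1`. -/
def IsRankOne (p : GenSpinFactor X) : Prop := p.1 = 1 / 2 ∧ ‖p.2‖ = 1 / 2

theorem IsRankOne.compl {p : GenSpinFactor X} (h : IsRankOne p) : IsRankOne (unit - p) := by
  constructor
  · simp [h.1]; norm_num
  · simp [h.2]

theorem IsRankOne.ne_zero {p : GenSpinFactor X} (h : IsRankOne p) : p ≠ 0 := by
  rintro rfl
  simpa using h.1

theorem IsRankOne.ne_unit {p : GenSpinFactor X} (h : IsRankOne p) : p ≠ unit := by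
  rintro rfl
  simpa using h.1

theorem IsRankOne.nonneg {p : GenSpinFactor X} (h : IsRankOne p) : 0 ≤ p := by
  rw [nonneg_iff, h.1, h.2]

theorem IsRankOne.le_unit {p : GenSpinFactor X} (h : IsRankOne p) : p ≤ unit :=
  sub_nonneg.1 h.compl.nonneg

theorem IsRankOne.eq_of_le {p q : GenSpinFactor X} (hp : IsRankOne p) (hq : IsRankOne q)
    (h : p ≤ q) : p = q := by
  rw [le_def, hp.1, hq.1, sub_self, norm_le_zero_iff, sub_eq_zero] at h
  exact ext' (hp.1.trans hq.1.symm) h.symm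

/-- The focus of a compression is trivial or of rank one. -/
theorem focus_cases {p : GenSpinFactor X} {J : GenSpinFactor X →ₗ[ℝ] GenSpinFactor X}
    (h : IsCompression p J) : p = 0 ∨ p = unit ∨ IsRankOne p := by
  obtain ⟨h0, h1⟩ := h.focus_mem
  have k0 := (nonneg_iff p).1 h0
  have k1 := (nonneg_iff _).1 (sub_nonneg.2 h1)
  simp at k1
  by_cases hz : p = 0
  · exact Or.inl hz
  by_cases hu : p = unit
  · exact Or.inr (Or.inl hu)
  right; right
  have p1 : 0 < p.1 := (effect_fst h0).lt_of_ne' fun h => hz (eq_zero_of_nonneg h0 h)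
  have p2 : p.1 < 1 := by
    by_contra hc
    have : unit - p = 0 := eq_zero_of_nonneg (sub_nonneg.2 h1)
      (by simp; linarith [norm_nonneg p.2])
    exact hu (sub_eq_zero.1 this).symm
  -- Each bad value of p is refuted by a nonzero effect below both p and 1 - p.
  have small : ∀ e : GenSpinFactor X, 0 ≤ e → 0 < e.1 → e ≤ p → ¬ e ≤ unit - p := by
    intro e e0 e1 h2 h3
    rw [h.sharp e0 h2 h3] at e1
    simp at e1
  rcases lt_trichotomy p.1 (1 / 2) with hlt | heq | hgt
  · exfalso
    -- With α = p.1 and ‖p.2‖ ≤ α, the bound by 1 - p reduces to (1 - 2α)² ≥ 0. The case α > 1/2 is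
    -- this one for 1 - p.
    refine small ((1 - 2 * p.1) • p) ?_ ?_ ?_ ?_
    · exact smul_nonneg' _ _ (by linarith) h0
    · exact mul_pos (by linarith) p1
    · rw [le_def]
      have : p.2 - ((1 - 2 * p.1) • p).2 = (2 * p.1) • p.2 := by simp; module
      rw [this, norm_smul, Real.norm_of_nonneg (by linarith)]
      simp
      nlinarith
    · rw [le_def]
      have : (unit - p).2 - ((1 - 2 * p.1) • p).2 = (-(2 - 2 * p.1)) • p.2 := by simp; module
      rw [this, norm_smul, norm_neg, Real.norm_of_nonneg (by linarith)]
      simp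
      nlinarith
  · refine ⟨heq, le_antisymm (by linarith) ?_⟩
    by_contra! hc
    refine small ((1 / 2 - ‖p.2‖) • unit) ?_ ?_ ?_ ?_
    · exact smul_nonneg' _ _ (by linarith) unit_nonneg
    · simp; linarith
    · rw [le_def]; simp; linarith
    · rw [le_def]; simp; linarith
  · exfalso
    refine small ((2 * p.1 - 1) • (unit - p)) ?_ ?_ ?_ ?_
    · exact smul_nonneg' _ _ (by linarith) (sub_nonneg.2 h1)
    · exact mul_pos (by linarith) (sub_pos.2 p2)
    · rw [le_def]
      have : p.2 - ((2 * p.1 - 1) • (unit - p)).2 = (2 * p.1) • p.2 := by simp; module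
      rw [this, norm_smul, Real.norm_of_nonneg (by linarith)]
      simp
      nlinarith
    · rw [le_def]
      have : (unit - p).2 - ((2 * p.1 - 1) • (unit - p)).2 = (-(2 - 2 * p.1)) • p.2 := by
        simp; module
      rw [this, norm_smul, norm_neg, Real.norm_of_nonneg (by linarith)]
      simp
      nlinarith

/-! ### Consequences of comparability for rank one elements. -/

section SpectralBase

variable {B : CompressionBase (GenSpinFactor X)}

/-- The compressions of a base with the comparability property have rank at most one at foci of
rank one. -/
theorem eq_smul_of_le (hB : B.HasComparability) {p e : GenSpinFactor X} (hp : p ∈ B.P)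
    (hp1 : IsRankOne p) (e0 : 0 ≤ e) (e1 : e ≤ p) : e = (2 * e.1) • p := by
  have cp := B.isCompression p hp
  have cp' := B.isCompression _ (B.compl_mem p hp)
  have Jp' : B.J (unit - p) p = 0 := by simpa using cp'.map_compl
  have Je : B.J p e = e := cp.map_eq_self e ⟨e0, e1.trans cp.focus_mem.2⟩ e1
  have Je' : B.J (unit - p) e = 0 :=
    le_antisymm (by simpa [Jp'] using cp'.mono e1) (cp'.positive e e0)
  -- The multiple of p is chosen to make the scalar part of a vanish, so a = 0 once a is comparable
  -- with 0. Since J_p a = a and J_{1-p} a = 0, p commutes with a, hence with the projection r that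
  -- comparability gives for a.
  set a := e - (2 * e.1) • p with ha
  have Ja : B.J p a = a := by rw [ha, map_sub, map_smul, Je, cp.map_focus]
  have Ja' : B.J (unit - p) a = 0 := by rw [ha, map_sub, map_smul, Je', Jp']; simp
  have a1 : a.1 = 0 := by simp [ha, hp1.1]; ring
  obtain ⟨r, ⟨hr, hrc⟩, hr1, hr2⟩ := hB a
  have cr := B.isCompression r hr
  have hrp : B.Commutes p r := by
    refine hrc p (Or.inl ⟨hp, ?_⟩)
    rintro _ rfl
    simp [CompressionBase.Commutes, Ja, Ja']
  have hra : B.Commutes a r := hrc a (Or.inr rfl)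
  suffices h : 0 ≤ a ∨ a ≤ 0 by
    have : a = 0 := by
      rcases h with h | h
      · exact eq_zero_of_nonneg h a1
      · exact neg_eq_zero.1 (eq_zero_of_nonneg (neg_nonneg.2 h) (by simp [a1]))
    exact sub_eq_zero.1 this
  rcases focus_cases cr with rfl | rfl | hr3
  · right; simpa [B.J_unit] using hr1
  · left; simpa [B.J_unit] using hr2
  -- J_r p is a projection below both r and p, and distinct rank one elements are incomparable:
  -- either p = 1 - r or p = r, so a has the sign of the matching part.
  · have hs := hrp.map_mem hp hr
    have cr' := B.isCompression _ (B.compl_mem r hr)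
    have hs1 : B.J r p ≤ r := cr.map_le cp.focus_mem.2
    have hs2 : B.J r p ≤ p := by
      have := cr'.positive p cp.focus_mem.1
      unfold CompressionBase.Commutes at hrp
      nth_rw 2 [hrp]
      exact le_add_of_nonneg_right this
    rcases focus_cases (B.isCompression _ hs) with h | h | h
    · have : p ≤ unit - r := by
        rw [hrp, h, zero_add]
        exact cr'.map_le cp.focus_mem.2
      have := hp1.eq_of_le hr3.compl this
      rw [← this, Ja] at hr1
      exact Or.inr hr1
    · exact absurd (le_antisymm cr.focus_mem.2 (h ▸ hs1)) hr3.ne_unit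
    · have := (h.eq_of_le hr3 hs1).symm.trans (h.eq_of_le hp1 hs2)
      rw [this, Ja] at hr2
      exact Or.inl hr2

theorem J_eq_smul (hB : B.HasComparability) {p : GenSpinFactor X} (hp : p ∈ B.P)
    (hp1 : IsRankOne p) (a : GenSpinFactor X) : B.J p a = (2 * (B.J p a).1) • p := by
  have cp := B.isCompression p hp
  have : B.J p = (((2 : ℝ) • fstL) ∘ₗ B.J p).smulRight p :=
    linearMap_ext_effects fun e he => by
      simpa using eq_smul_of_le hB hp hp1 (cp.positive e he.1) (cp.map_le he.2)
  simpa using congrArg (fun f => f a) this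

/-- In a base with the comparability property, all rank one elements are projections. -/
theorem rankOne_mem (hB : B.HasComparability) {p : GenSpinFactor X} (hp : IsRankOne p) :
    p ∈ B.P := by
  -- Comparability for (0, p.2) must return p itself: r is not trivial because ±(0, p.2) is not
  -- positive, and commutation makes p.2 a multiple of r.2.
  obtain ⟨r, ⟨hr, hrc⟩, hr1, hr2⟩ := hB (inr p.2)
  have hra : B.Commutes (inr p.2) r := hrc _ (Or.inr rfl)
  have hne : ∀ a : GenSpinFactor X, 0 ≤ a → a.1 = 0 → ‖a.2‖ = 1 / 2 → False := by
    intro a h0 h1 h2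
    rw [eq_zero_of_nonneg h0 h1] at h2
    simp at h2
  rcases focus_cases (B.isCompression r hr) with rfl | rfl | hr3
  · refine (hne (-inr p.2) ?_ (by simp) (by simp [hp.2])).elim
    simpa [B.J_unit] using hr1
  · refine (hne (inr p.2) ?_ (by simp) (by simp [hp.2])).elim
    simpa [B.J_unit] using hr2
  · have e1 := J_eq_smul hB hr hr3 (inr p.2)
    have e2 := J_eq_smul hB (B.compl_mem r hr) hr3.compl (inr p.2)
    unfold CompressionBase.Commutes at hra
    set s := (B.J r (inr p.2)).1
    set t := (B.J (unit - r) (inr p.2)).1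
    -- This sign rules out p = 1 - r.
    have s0 : 0 ≤ s := effect_fst hr2
    rw [e1, e2] at hra
    obtain ⟨h1, h2⟩ := ext_iff'.1 hra
    simp [hr3.1] at h1 h2
    have ht : t = -s := by linarith
    have h3 : p.2 = (4 * s) • r.2 := by rw [h2, ht]; module
    have h4 : (4 * s) = 1 := by
      have := congrArg norm h3
      rw [norm_smul, hp.2, hr3.2, Real.norm_of_nonneg (by linarith)] at this
      linarith
    rw [h4, one_smul] at h3
    have : p = r := ext' (hp.1.trans hr3.1.symm) h3
    rwa [this]

end SpectralBase

end GenSpinFactor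

/-! ### Passing from the dual norm to the norm of X. -/

/-- The parallelogram law for the norm of `X` follows from that of the dual space. -/
theorem parallelogram_of_dual {X : Type u} [NormedAddCommGroup X] [NormedSpace ℝ X]
    (h : ∀ f g : StrongDual ℝ X, ‖f + g‖ ^ 2 + ‖f - g‖ ^ 2 = 2 * (‖f‖ ^ 2 + ‖g‖ ^ 2)) (x w : X) :
    ‖x + w‖ ^ 2 + ‖x - w‖ ^ 2 = 2 * (‖x‖ ^ 2 + ‖w‖ ^ 2) := by
  -- One inequality suffices: applied to x + w and x - w it gives the reverse one. For its proof, f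
  -- and g norm x + w and x - w.
  have key : ∀ x w : X, ‖x + w‖ ^ 2 + ‖x - w‖ ^ 2 ≤ 2 * (‖x‖ ^ 2 + ‖w‖ ^ 2) := by
    intro x w
    obtain ⟨f, hf, hf'⟩ := exists_dual_vector'' ℝ (x + w)
    obtain ⟨g, hg, hg'⟩ := exists_dual_vector'' ℝ (x - w)
    simp only [RCLike.ofReal_real_eq_id, id_eq] at hf' hg'
    set P := ‖x + w‖ with hP
    set Q := ‖x - w‖ with hQ
    have hP0 : 0 ≤ P := norm_nonneg _
    have hQ0 : 0 ≤ Q := norm_nonneg _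
    have h1 := h (P • f) (Q • g)
    set u := P • f + Q • g with hu
    set v := P • f - Q • g with hv
    rw [norm_smul, norm_smul, Real.norm_of_nonneg hP0, Real.norm_of_nonneg hQ0] at h1
    have hux : u x ≤ ‖u‖ * ‖x‖ := (le_abs_self _).trans (u.le_opNorm x)
    have hvw : v w ≤ ‖v‖ * ‖w‖ := (le_abs_self _).trans (v.le_opNorm w)
    have e : P ^ 2 + Q ^ 2 = u x + v w := by
      rw [map_add] at hf'
      rw [map_sub] at hg'
      simp only [hu, hv, add_apply, sub_apply,
        smul_apply, smul_eq_mul]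
      linear_combination (-P) * hf' - Q * hg'
    have h2 : (P * ‖f‖) ^ 2 ≤ P ^ 2 :=
      pow_le_pow_left₀ (by positivity) (mul_le_of_le_one_right hP0 hf) 2
    have h3 : (Q * ‖g‖) ^ 2 ≤ Q ^ 2 :=
      pow_le_pow_left₀ (by positivity) (mul_le_of_le_one_right hQ0 hg) 2
    -- P² + Q² ≤ ‖u‖‖x‖ + ‖v‖‖w‖ ≤ (‖u‖² + ‖v‖²)/4 + ‖x‖² + ‖w‖², and the dual law bounds ‖u‖² +
    -- ‖v‖² by 2(P² + Q²).
    nlinarith [sq_nonneg (‖u‖ - 2 * ‖x‖), sq_nonneg (‖v‖ - 2 * ‖w‖)]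
  refine le_antisymm (key x w) ?_
  have := key (x + w) (x - w)
  have e1 : x + w + (x - w) = (2 : ℝ) • x := by module
  have e2 : x + w - (x - w) = (2 : ℝ) • w := by module
  rw [e1, e2, norm_smul, norm_smul] at this
  simp only [Real.norm_ofNat] at this
  linarith

theorem isSpinFactor_of_dual_parallelogram {X : Type u} [NormedAddCommGroup X] [NormedSpace ℝ X]
    (h : ∀ f g : StrongDual ℝ X, ‖f + g‖ ^ 2 + ‖f - g‖ ^ 2 = 2 * (‖f‖ ^ 2 + ‖g‖ ^ 2)) :
    IsSpinFactor X := by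
  refine ⟨InnerProductSpace.ofNorm ℝ fun x y => ?_, rfl⟩
  simpa only [sq] using parallelogram_of_dual h x y

/-! ### The parallelogram law in X*, from the JB condition and from a JB product. -/

namespace GenSpinFactor

open OrderUnitSpace

variable {X : Type u} [NormedAddCommGroup X] [NormedSpace ℝ X]

theorem _root_.OrderUnitSpace.IsCompression.map_eq {p : GenSpinFactor X}
    {J : GenSpinFactor X →ₗ[ℝ] GenSpinFactor X} (h : IsCompression p J) (a : GenSpinFactor X) :
    J a = a.1 • p + J (inr a.2) := by
  conv_lhs => rw [eq_smul_unit_add a, map_add, map_smul, h.map_unit]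

/-- The difference of the scalar parts of `J_p (0, z)` and `J_{1-p} (0, z)`. -/
noncomputable def scalarDiff (B : CompressionBase (GenSpinFactor X)) (p : GenSpinFactor X) :
    StrongDual ℝ X →ₗ[ℝ] ℝ :=
  fstL ∘ₗ (B.J p - B.J (unit - p)) ∘ₗ inr

/-- From J_p p = p and J_{1-p} p = 0, the two scalar parts at (0, p.2) are 1/4 and -1/4. -/
theorem scalarDiff_self {B : CompressionBase (GenSpinFactor X)} {p : GenSpinFactor X}
    (hp : p ∈ B.P) (hp1 : IsRankOne p) : scalarDiff B p p.2 = 1 / 2 := by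
  have cp := B.isCompression p hp
  have cp' := B.isCompression _ (B.compl_mem p hp)
  have h1 := cp.map_eq p
  have h2 := cp'.map_eq p
  have h3 := cp'.map_compl
  rw [sub_sub_cancel] at h3
  rw [cp.map_focus] at h1
  rw [h3] at h2
  have h1 := (ext_iff'.1 h1).1
  have h2 := (ext_iff'.1 h2).1
  simp [hp1.1] at h1 h2
  simp [scalarDiff]
  linarith

theorem scalarDiff_comm {B : CompressionBase (GenSpinFactor X)} (hB : B.JBCondition)
    {p q : GenSpinFactor X} (hp : p ∈ B.P) (hp1 : IsRankOne p) (hq : q ∈ B.P)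
    (hq1 : IsRankOne q) : scalarDiff B p q.2 = scalarDiff B q p.2 := by
  have key : ∀ p q : GenSpinFactor X, p ∈ B.P → IsRankOne p → IsRankOne q →
      (B.J p q + B.J (unit - p) (unit - q)).1 = 1 / 2 + scalarDiff B p q.2 := by
    intro p q hp hp1 hq1
    have cp := B.isCompression p hp
    have cp' := B.isCompression _ (B.compl_mem p hp)
    have e1 := cp.map_eq q
    have e2 := cp'.map_eq (unit - q)
    rw [e1, e2]
    simp [hp1.1, hq1.1, scalarDiff]
    ring
  have := congrArg Prod.fst (hB p hp q hq)
  rw [key p q hp hp1 hq1, key q p hq hq1 hp1] at this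
  linarith

theorem dual_parallelogram_of_jbCondition {B : CompressionBase (GenSpinFactor X)}
    (hB : B.IsSpectral) (hJB : B.JBCondition) (f g : StrongDual ℝ X) :
    ‖f + g‖ ^ 2 + ‖f - g‖ ^ 2 = 2 * (‖f‖ ^ 2 + ‖g‖ ^ 2) := by
  set P : StrongDual ℝ X → GenSpinFactor X := fun y => mk (1 / 2) ((1 / (2 * ‖y‖)) • y) with hP
  have P1 : ∀ y, y ≠ 0 → IsRankOne (P y) := fun y hy => by
    have := norm_pos_iff.2 hy
    refine ⟨rfl, ?_⟩
    simp [hP, norm_smul]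
    field_simp
  have Pm : ∀ y, y ≠ 0 → P y ∈ B.P := fun y hy => rankOne_mem hB.2 (P1 y hy)
  -- The factor ‖y‖ normalises b(y, y) to ‖y‖². Linearity is evident only in z; the JB condition
  -- supplies symmetry, and with it additivity in y.
  set b : StrongDual ℝ X → StrongDual ℝ X → ℝ := fun y z => ‖y‖ * scalarDiff B (P y) z with hb
  have bself : ∀ y, b y y = ‖y‖ ^ 2 := by
    intro y
    rcases eq_or_ne y 0 with rfl | hy
    · simp [hb]
    · have := scalarDiff_self (Pm y hy) (P1 y hy)
      have hn := norm_pos_iff.2 hy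
      simp only [hP, mk_snd, map_smul, smul_eq_mul] at this
      simp only [hb, hP]
      field_simp at this
      rw [this]
      ring
  have bcomm : ∀ y z, b y z = b z y := by
    intro y z
    rcases eq_or_ne y 0 with rfl | hy
    · simp [hb]
    rcases eq_or_ne z 0 with rfl | hz
    · simp [hb]
    have := scalarDiff_comm hJB (Pm y hy) (P1 y hy) (Pm z hz) (P1 z hz)
    have hn := norm_pos_iff.2 hy
    have hn' := norm_pos_iff.2 hz
    simp only [hP, mk_snd, map_smul, smul_eq_mul] at this
    simp only [hb, hP]
    field_simp at this
    exact this
  have badd : ∀ x y z, b x (y + z) = b x y + b x z := fun x y z => by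
    simp only [hb, map_add, mul_add]
  have bsub : ∀ x y z, b x (y - z) = b x y - b x z := fun x y z => by
    simp only [hb, map_sub, mul_sub]
  rw [← bself, ← bself, badd, bsub, bcomm _ f, bcomm _ g, bcomm _ f, bcomm _ g, badd, badd, bsub,
    bsub, bself, bself]
  ring

/-- In a JB-algebra structure on `ℝ × X*`, all squares are positive. -/
theorem mul_self_nonneg' {mul : GenSpinFactor X →ₗ[ℝ] GenSpinFactor X →ₗ[ℝ] GenSpinFactor X}
    (h : IsJBProduct (unit : GenSpinFactor X) mul) (b : GenSpinFactor X) : 0 ≤ mul b b := by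
  set d := mul b b with hd
  rw [nonneg_iff]
  by_contra! hlt
  obtain ⟨l, hl⟩ := exists_gt (‖d‖ ^ 2 / (2 * (‖d.2‖ - d.1)))
  have hm : 0 < ‖d.2‖ - d.1 := by linarith
  have hl0 : 0 < l := lt_of_le_of_lt (by positivity) hl
  rw [div_lt_iff₀ (by positivity)] at hl
  have mul_one : ∀ a, mul a unit = a := fun a => by rw [h.comm, h.one_mul]
  -- The second square is 2l d and cancels the cross term of (l1 - d)². With m = ‖d.2‖ - d.1 > 0
  -- this gives (l + m)² ≤ l² + ‖d‖², which fails for l > ‖d‖²/(2m).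
  have h1 := h.norm_sq_le (l • unit - d) (√(2 * l) • b)
  have e : mul (l • unit - d) (l • unit - d) + mul (√(2 * l) • b) (√(2 * l) • b) =
      (l ^ 2) • unit + mul d d := by
    simp only [map_sub, LinearMap.sub_apply, map_smul, LinearMap.smul_apply, h.one_mul, mul_one,
      smul_smul, Real.mul_self_sqrt (mul_pos two_pos hl0).le, ← hd]
    module
  rw [e, h.norm_sq] at h1
  have h2 : ‖(l ^ 2) • (unit : GenSpinFactor X) + mul d d‖ ≤ l ^ 2 + ‖d‖ ^ 2 := by
    refine (norm_add_le _ _).trans ?_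
    rw [h.norm_sq, norm_smul, norm_def unit]
    simp
  have h3 : l + (‖d.2‖ - d.1) ≤ ‖l • unit - d‖ := by
    rw [norm_def]
    simp
    linarith [le_abs_self (l - d.1)]
  have h4 := pow_le_pow_left₀ (by positivity) h3 2
  nlinarith

/-- With t = ‖y‖, the square d of (0, y) is positive of norm t², so d.1 ≤ t². The square of t1 + (0,
y) is positive of norm 4t², and a positive element has norm at most twice its scalar part, here t² +
d.1; hence d.1 ≥ t². -/
theorem mul_inr_self {mul : GenSpinFactor X →ₗ[ℝ] GenSpinFactor X →ₗ[ℝ] GenSpinFactor X}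
    (h : IsJBProduct (unit : GenSpinFactor X) mul) (y : StrongDual ℝ X) :
    (mul (inr y) (inr y)).1 = ‖y‖ ^ 2 := by
  set d := mul (inr y) (inr y) with hd
  have mul_one : ∀ a, mul a unit = a := fun a => by rw [h.comm, h.one_mul]
  have hn : ‖d‖ = ‖y‖ ^ 2 := by rw [hd, h.norm_sq, norm_def]; simp
  have d0 := mul_self_nonneg' h (inr y)
  have d1 := effect_fst d0
  rw [norm_def, abs_of_nonneg d1] at hn
  set t := ‖y‖ with ht
  rcases (norm_nonneg y).eq_or_lt' with h0 | h0
  · rw [h0] at ht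
    rw [ht] at hn ⊢
    nlinarith [norm_nonneg d.2]
  have e1 : mul (t • unit + inr y) (t • unit + inr y) =
      (t ^ 2) • unit + (2 * t) • inr y + d := by
    simp only [map_add, LinearMap.add_apply, map_smul, LinearMap.smul_apply, h.one_mul, mul_one,
      ← hd]
    module
  have p1 := mul_self_nonneg' h (t • unit + inr y)
  have n1 := h.norm_sq (t • unit + inr y)
  rw [e1] at n1 p1
  rw [nonneg_iff] at p1
  rw [norm_def, norm_def] at n1
  simp at n1 p1
  rw [abs_of_nonneg (by positivity), abs_of_nonneg (by positivity), ← ht] at n1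
  nlinarith [norm_nonneg d.2]

theorem dual_parallelogram_of_isJBProduct
    {mul : GenSpinFactor X →ₗ[ℝ] GenSpinFactor X →ₗ[ℝ] GenSpinFactor X}
    (h : IsJBProduct (unit : GenSpinFactor X) mul) (f g : StrongDual ℝ X) :
    ‖f + g‖ ^ 2 + ‖f - g‖ ^ 2 = 2 * (‖f‖ ^ 2 + ‖g‖ ^ 2) := by
  simp only [← mul_inr_self h, map_add, map_sub, LinearMap.add_apply, LinearMap.sub_apply,
    add_fst, sub_fst]
  ring

end GenSpinFactor

/-! ### Inner product geometry of X*. -/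

/-- A symmetric bilinear form on the dual of `X` inducing the dual norm. -/
structure DualInner (X : Type u) [NormedAddCommGroup X] [NormedSpace ℝ X] where
  /-- the bilinear form -/
  form : StrongDual ℝ X →ₗ[ℝ] StrongDual ℝ X →ₗ[ℝ] ℝ
  symm : ∀ y z, form y z = form z y
  self : ∀ y, form y y = ‖y‖ ^ 2

/-- The form is transported along the Riesz isometry, which is where completeness of X enters. -/
theorem IsSpinFactor.nonempty_dualInner {X : Type u} [NormedAddCommGroup X] [NormedSpace ℝ X]
    [CompleteSpace X] (h : IsSpinFactor X) : Nonempty (DualInner X) := by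
  obtain ⟨ip, rfl⟩ := h
  let e := (InnerProductSpace.toDual ℝ X).symm
  let L : StrongDual ℝ X →ₗ[ℝ] X :=
    { toFun := e
      map_add' := map_add e
      map_smul' := fun r y => by simp [e] }
  refine ⟨⟨(innerₗ X).compl₁₂ L L, fun y z => ?_, fun y => ?_⟩⟩
  · exact real_inner_comm _ _
  · exact (real_inner_self_eq_norm_sq (e y)).trans (by rw [e.norm_map])

namespace DualInner

variable {X : Type u} [NormedAddCommGroup X] [NormedSpace ℝ X] (φ : DualInner X)

theorem norm_add_smul_sq (y z : StrongDual ℝ X) (t : ℝ) :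
    ‖y + t • z‖ ^ 2 = ‖y‖ ^ 2 + 2 * t * φ.form y z + t ^ 2 * ‖z‖ ^ 2 := by
  rw [← φ.self, ← φ.self, ← φ.self]
  simp only [map_add, map_smul, LinearMap.add_apply, LinearMap.smul_apply, smul_eq_mul,
    φ.symm z y]
  ring

theorem abs_form_le (y z : StrongDual ℝ X) : |φ.form y z| ≤ ‖y‖ * ‖z‖ := by
  have h : ∀ t : ℝ, 0 ≤ ‖z‖ ^ 2 * (t * t) + (2 * φ.form y z) * t + ‖y‖ ^ 2 := fun t => by
    have := φ.norm_add_smul_sq y z t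
    nlinarith [sq_nonneg ‖y + t • z‖]
  have := discrim_le_zero h
  rw [discrim] at this
  refine abs_le_of_sq_le_sq ?_ (by positivity)
  nlinarith

/-- A functional of norm at most one that takes the value one at a unit vector `u` is the inner
product with `u`. -/
theorem eq_form (f : StrongDual ℝ X →ₗ[ℝ] ℝ) (hf : ∀ z, |f z| ≤ ‖z‖) {u : StrongDual ℝ X}
    (hu : ‖u‖ = 1) (hfu : f u = 1) (z : StrongDual ℝ X) : f z = φ.form u z := by
  -- This is f(u + tz)² ≤ ‖u + tz‖². With zero constant term, the discriminant is the square of the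
  -- linear coefficient, which must vanish.
  have h : ∀ t : ℝ, 0 ≤ (‖z‖ ^ 2 - f z ^ 2) * (t * t) + (2 * (φ.form u z - f z)) * t + 0 := by
    intro t
    have h1 := sq_le_sq.2 ((hf (u + t • z)).trans (le_abs_self _))
    rw [φ.norm_add_smul_sq, hu, map_add, map_smul, hfu, smul_eq_mul] at h1
    nlinarith
  have := discrim_le_zero h
  rw [discrim] at this
  nlinarith [sq_nonneg (φ.form u z - f z)]

end DualInner

namespace GenSpinFactor

open OrderUnitSpace

variable {X : Type u} [NormedAddCommGroup X] [NormedSpace ℝ X] (φ : DualInner X)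

/-- The projection onto the dual space, as a linear map. -/
def sndL : GenSpinFactor X →ₗ[ℝ] StrongDual ℝ X where
  toFun a := a.2
  map_add' _ _ := rfl
  map_smul' _ _ := rfl

/-- The rank one compression `(α, z) ↦ (α + 2 ⟨p.2, z⟩) p`. -/
noncomputable def rankOneMap (p : GenSpinFactor X) : GenSpinFactor X →ₗ[ℝ] GenSpinFactor X :=
  (fstL + (2 : ℝ) • (φ.form p.2 ∘ₗ sndL)).smulRight p

theorem rankOneMap_apply (p a : GenSpinFactor X) :
    rankOneMap φ p a = (a.1 + 2 * φ.form p.2 a.2) • p := rfl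

/-! ### The JB condition for spectral bases of a spin factor -/

/-- J_p takes values in ℝp, so only the functional f is unknown. Positivity bounds it by the norm,
and J_p p = p makes it 1 at the unit vector 2 p.2, which determines it. -/
theorem J_eq_rankOneMap {B : CompressionBase (GenSpinFactor X)} (hB : B.HasComparability)
    {p : GenSpinFactor X} (hp : p ∈ B.P) (hp1 : IsRankOne p) : B.J p = rankOneMap φ p := by
  have cp := B.isCompression p hp
  set f : StrongDual ℝ X →ₗ[ℝ] ℝ := (2 : ℝ) • (fstL ∘ₗ B.J p ∘ₗ inr) with hf
  have f_apply : ∀ z, f z = 2 * (B.J p (inr z)).1 := fun z => rfl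
  have f_lower : ∀ z, -‖z‖ ≤ f z := by
    intro z
    have h1 : (0 : GenSpinFactor X) ≤ ‖z‖ • unit + inr z := by
      rw [nonneg_iff]
      simp
    have h2 := effect_fst (cp.positive _ h1)
    rw [map_add, map_smul, cp.map_unit] at h2
    simp [hp1.1] at h2
    rw [f_apply]
    linarith
  have f_le : ∀ z, |f z| ≤ ‖z‖ := by
    intro z
    have h1 := f_lower (-z)
    rw [norm_neg, map_neg] at h1
    exact abs_le.2 ⟨f_lower z, by linarith⟩
  have f_self : f ((2 : ℝ) • p.2) = 1 := by
    have h1 := cp.map_eq p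
    rw [cp.map_focus] at h1
    have h1 := (ext_iff'.1 h1).1
    simp [hp1.1] at h1
    rw [map_smul, f_apply, smul_eq_mul]
    linarith
  ext1 a
  have h1 := φ.eq_form f f_le (u := (2 : ℝ) • p.2) (by rw [norm_smul, hp1.2]; norm_num) f_self a.2
  rw [J_eq_smul hB hp hp1 a, rankOneMap_apply]
  congr 1
  have h2 := (ext_iff'.1 (cp.map_eq a)).1
  simp [hp1.1] at h2
  rw [f_apply] at h1
  simp at h1
  linarith

/-- For rank one p and q both sides equal (1/2 + 2⟨p.2, q.2⟩) times the unit. -/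
theorem jbCondition_of_hasComparability (φ : DualInner X) {B : CompressionBase (GenSpinFactor X)}
    (hB : B.HasComparability) : B.JBCondition := by
  intro p hp q hq
  rcases focus_cases (B.isCompression p hp) with h | h | hp1
  · exact CompressionBase.jb_of_trivial (Or.inl h) hq
  · exact CompressionBase.jb_of_trivial (Or.inr h) hq
  rcases focus_cases (B.isCompression q hq) with h | h | hq1
  · exact (CompressionBase.jb_of_trivial (Or.inl h) hp).symm
  · exact (CompressionBase.jb_of_trivial (Or.inr h) hp).symm
  rw [J_eq_rankOneMap φ hB hp hp1, J_eq_rankOneMap φ hB hq hq1,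
    J_eq_rankOneMap φ hB (B.compl_mem p hp) hp1.compl,
    J_eq_rankOneMap φ hB (B.compl_mem q hq) hq1.compl]
  simp only [rankOneMap_apply, sub_fst, sub_snd, unit_fst, unit_snd, hp1.1, hq1.1, zero_sub,
    map_neg, LinearMap.neg_apply, neg_neg, φ.symm q.2 p.2]
  module

/-! ### The standard compression base of a spin factor -/

theorem _root_.DualInner.eq_smul_of_le (φ : DualInner X) {p e : GenSpinFactor X} (hp : IsRankOne p) (e0 : 0 ≤ e)
    (e1 : e ≤ p) : e = (2 * e.1) • p := by
  have h0 := effect_fst e0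
  rw [nonneg_iff] at e0
  rw [le_def, hp.1] at e1
  have h1 := φ.norm_add_smul_sq p.2 e.2 (-1)
  have h2 := φ.norm_add_smul_sq e.2 p.2 (-(2 * e.1))
  rw [neg_one_smul ℝ e.2, ← sub_eq_add_neg] at h1
  rw [hp.2] at h1 h2
  rw [φ.symm e.2] at h2
  have h3 := pow_le_pow_left₀ (norm_nonneg _) e1 2
  have h4 := pow_le_pow_left₀ (norm_nonneg _) e0 2
  have h5 := norm_nonneg (p.2 - e.2)
  -- With α = e.1 ≤ 1/2, the bound e ≤ p estimates this square by (1 - 2α)(‖e.2‖² - α²), which is at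
  -- most 0 because e ≥ 0.
  have h6 : ‖e.2 + (-(2 * e.1)) • p.2‖ ^ 2 ≤ 0 := by
    rw [h2]
    nlinarith
  have h7 := norm_eq_zero.1 (pow_eq_zero_iff two_ne_zero |>.1 (le_antisymm h6 (sq_nonneg _)))
  refine ext' (by simp [hp.1]; ring) ?_
  rw [neg_smul (2 * e.1) p.2, ← sub_eq_add_neg] at h7
  exact sub_eq_zero.1 h7

theorem rankOneMap_unit (p : GenSpinFactor X) : rankOneMap φ p unit = p := by
  simp [rankOneMap_apply]

theorem rankOneMap_self {p : GenSpinFactor X} (hp : IsRankOne p) : rankOneMap φ p p = p := by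
  rw [rankOneMap_apply, φ.self, hp.1, hp.2]
  norm_num

theorem isCompression_rankOneMap {p : GenSpinFactor X} (hp : IsRankOne p) :
    IsCompression p (rankOneMap φ p) where
  positive a ha := by
    rw [rankOneMap_apply]
    refine smul_nonneg' _ _ ?_ hp.nonneg
    have h1 := φ.abs_form_le p.2 a.2
    rw [hp.2] at h1
    rw [nonneg_iff] at ha
    linarith [neg_le_of_abs_le h1]
  map_unit := rankOneMap_unit φ p
  focus_mem := ⟨hp.nonneg, hp.le_unit⟩
  map_eq_self e he hep := by
    rw [φ.eq_smul_of_le hp he.1 hep, map_smul, rankOneMap_self φ hp]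
  le_of_map_eq_zero e he h := by
    rw [rankOneMap_apply, smul_eq_zero_iff_left hp.ne_zero] at h
    have h2 := φ.norm_add_smul_sq e.2 p.2 (2 * e.1)
    rw [φ.symm e.2, hp.2] at h2
    have h0 := effect_fst he.1
    have h3 := (nonneg_iff e).1 he.1
    have h4 := pow_le_pow_left₀ (norm_nonneg _) h3 2
    -- On the kernel 2⟨p.2, e.2⟩ = -e.1, so the square equals ‖e.2‖² - e.1². Thus e is a multiple of
    -- 1 - p.
    have h6 : ‖e.2 + (2 * e.1) • p.2‖ ^ 2 ≤ 0 := by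
      rw [h2]
      nlinarith
    have h7 := norm_eq_zero.1 (pow_eq_zero_iff two_ne_zero |>.1 (le_antisymm h6 (sq_nonneg _)))
    have h8 : e = (2 * e.1) • (unit - p) := by
      refine ext' (by simp [hp.1]; ring) ?_
      simp only [smul_snd, sub_snd, unit_snd, zero_sub, smul_neg]
      exact eq_neg_of_add_eq_zero_left h7
    have h9 : 2 * e.1 ≤ 1 := by
      have h10 := (le_def _ _).1 he.2
      have h11 := congrArg norm (eq_neg_of_add_eq_zero_left h7)
      rw [norm_neg, norm_smul, hp.2, Real.norm_of_nonneg (by linarith)] at h11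
      simp at h10
      linarith
    have h12 : (0 : GenSpinFactor X) ≤ (1 - 2 * e.1) • (unit - p) :=
      smul_nonneg' _ _ (by linarith) hp.compl.nonneg
    rw [sub_smul, one_smul, ← h8] at h12
    exact sub_nonneg.1 h12

open Classical in
/-- The compressions of a spin factor. -/
noncomputable def spinJ (p : GenSpinFactor X) : GenSpinFactor X →ₗ[ℝ] GenSpinFactor X :=
  -- The rank one formula is already correct at p = 0.
  if p = unit then LinearMap.id else rankOneMap φ p

theorem zero_ne_unit : (0 : GenSpinFactor X) ≠ unit := fun h => by
  simpa using (ext_iff'.1 h).1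

theorem spinJ_unit : spinJ φ unit = LinearMap.id := if_pos rfl

theorem spinJ_zero : spinJ φ 0 = 0 := by
  rw [spinJ, if_neg zero_ne_unit]
  ext1 a
  simp [rankOneMap_apply]

theorem spinJ_of_isRankOne {p : GenSpinFactor X} (hp : IsRankOne p) :
    spinJ φ p = rankOneMap φ p := if_neg hp.ne_unit

theorem isCompression_id : IsCompression (unit : GenSpinFactor X) LinearMap.id where
  positive _ h := h
  map_unit := rfl
  focus_mem := unit_mem_effects
  map_eq_self _ _ _ := rfl
  le_of_map_eq_zero e _ h := by rw [sub_self]; exact le_of_eq h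

theorem isCompression_zero : IsCompression (0 : GenSpinFactor X) 0 where
  positive _ _ := le_rfl
  map_unit := rfl
  focus_mem := zero_mem_effects
  map_eq_self e he h := le_antisymm he.1 h
  le_of_map_eq_zero e he _ := by rw [sub_zero]; exact he.2

/-- The projections of a spin factor. -/
def spinProj (X : Type u) [NormedAddCommGroup X] [NormedSpace ℝ X] : Set (GenSpinFactor X) :=
  {p | p = 0 ∨ p = unit ∨ IsRankOne p}

theorem isCompression_spinJ {p : GenSpinFactor X} (hp : p ∈ spinProj X) :
    IsCompression p (spinJ φ p) := by
  rcases hp with rfl | rfl | hp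
  · rw [spinJ_zero]; exact isCompression_zero
  · rw [spinJ_unit]; exact isCompression_id
  · rw [spinJ_of_isRankOne φ hp]; exact isCompression_rankOneMap φ hp

theorem compl_mem_spinProj {p : GenSpinFactor X} (hp : p ∈ spinProj X) :
    unit - p ∈ spinProj X := by
  rcases hp with rfl | rfl | hp
  · exact Or.inr (Or.inl (sub_zero _))
  · exact Or.inl (sub_self _)
  · exact Or.inr (Or.inr hp.compl)

theorem spinProj_nonneg {p : GenSpinFactor X} (hp : p ∈ spinProj X) : 0 ≤ p := by
  rcases hp with rfl | rfl | hp
  · exact le_rfl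
  · exact unit_nonneg
  · exact hp.nonneg

theorem eq_zero_or_eq_compl {p r : GenSpinFactor X} (hp : p ∈ spinProj X) (hr : IsRankOne r)
    (h : p ≤ unit - r) : p = 0 ∨ p = unit - r := by
  rcases hp with rfl | rfl | hp
  · exact Or.inl rfl
  · exact absurd (le_antisymm hr.compl.le_unit h) hr.compl.ne_unit
  · exact Or.inr (hp.eq_of_le hr.compl h)

theorem add_mem_spinProj {p q : GenSpinFactor X} (hp : p ∈ spinProj X) (hq : q ∈ spinProj X)
    (h : p + q ≤ unit) : p + q ∈ spinProj X := by
  rcases id hq with rfl | rfl | hq1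
  · rwa [add_zero]
  · have : p = 0 := le_antisymm (by simpa using h) (spinProj_nonneg hp)
    rwa [this, zero_add]
  · rcases eq_zero_or_eq_compl hp hq1 (le_sub_iff_add_le.2 h) with rfl | rfl
    · rwa [zero_add]
    · rw [sub_add_cancel]
      exact Or.inr (Or.inl rfl)

/-- In the main case d ≠ 0 is a multiple of two rank one elements, which must then coincide. The sum
d + e + f is (2 - 2 d.1) times their common value, and being below 1 forces d.1 ≥ 1/2, hence e = 0.
-/
theorem spinProj_normal (φ : DualInner X) {d e f : GenSpinFactor X} (d0 : 0 ≤ d) (e0 : 0 ≤ e) (f0 : 0 ≤ f)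
    (h : d + e + f ≤ unit) (hde : d + e ∈ spinProj X) (hdf : d + f ∈ spinProj X) :
    d ∈ spinProj X := by
  rcases id hde with h1 | h1 | h1
  · exact Or.inl (le_antisymm (h1 ▸ le_add_of_nonneg_right e0) d0)
  · have : f = 0 := le_antisymm (by simpa [h1] using h) f0
    simpa [this] using hdf
  rcases id hdf with h2 | h2 | h2
  · exact Or.inl (le_antisymm (h2 ▸ le_add_of_nonneg_right f0) d0)
  · have : e = 0 := le_antisymm (by simpa [add_right_comm d e f, h2] using h) e0
    simpa [this] using hde
  have k1 := φ.eq_smul_of_le h1 d0 (le_add_of_nonneg_right e0)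
  have k2 := φ.eq_smul_of_le h2 d0 (le_add_of_nonneg_right f0)
  rcases eq_or_ne d.1 0 with hz | hz
  · exact Or.inl (eq_zero_of_nonneg d0 hz)
  have k3 : d + e = d + f :=
    smul_right_injective _ (mul_ne_zero two_ne_zero hz) (k1.symm.trans k2)
  have k4 : d + e + f = (2 - 2 * d.1) • (d + e) := by
    have : d + e + f = (d + e) + (d + f) - d := by abel
    rw [this, ← k3]
    nth_rw 3 [k1]
    module
  have hd := effect_fst d0
  have he := effect_fst e0
  have hde1 := h1.1
  rw [add_fst] at hde1
  rw [k4, le_def, unit_snd, zero_sub, norm_neg, smul_snd, norm_smul, h1.2,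
    Real.norm_of_nonneg (by linarith), smul_fst, h1.1, unit_fst] at h
  have : e = 0 := eq_zero_of_nonneg e0 (by linarith)
  simpa [this] using hde

theorem spinJ_comp {p q r : GenSpinFactor X} (hp : p ∈ spinProj X) (hq : q ∈ spinProj X)
    (hr : r ∈ spinProj X) (h : p + q + r ≤ unit) :
    spinJ φ (p + r) ∘ₗ spinJ φ (q + r) = spinJ φ r := by
  have p0 := spinProj_nonneg hp
  have q0 := spinProj_nonneg hq
  rcases id hr with rfl | rfl | hr1
  · simp only [add_zero] at h ⊢
    rcases id hq with rfl | rfl | hq1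
    · simp [spinJ_zero]
    · have : p = 0 := le_antisymm (by simpa using h) p0
      simp [this, spinJ_zero]
    · rcases eq_zero_or_eq_compl hp hq1 (le_sub_iff_add_le.2 h) with rfl | rfl
      · simp [spinJ_zero]
      · rw [spinJ_of_isRankOne φ hq1.compl, spinJ_of_isRankOne φ hq1, spinJ_zero]
        ext1 a
        have := (isCompression_rankOneMap φ hq1.compl).map_compl
        rw [sub_sub_cancel] at this
        rw [LinearMap.comp_apply, rankOneMap_apply φ q, map_smul, this]
        simp
  · have hpq : p + q ≤ 0 := by simpa using h
    have hp' : p = 0 := le_antisymm ((le_add_of_nonneg_right q0).trans hpq) p0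
    have hq' : q = 0 := le_antisymm ((le_add_of_nonneg_left p0).trans hpq) q0
    simp [hp', hq', spinJ_unit]
  · have hpq := le_sub_iff_add_le.2 h
    rcases eq_zero_or_eq_compl hp hr1 ((le_add_of_nonneg_right q0).trans hpq) with rfl | rfl <;>
    rcases eq_zero_or_eq_compl hq hr1 ((le_add_of_nonneg_left p0).trans hpq) with rfl | rfl
    · rw [zero_add, spinJ_of_isRankOne φ hr1]
      ext1 a
      rw [LinearMap.comp_apply, rankOneMap_apply φ r a, map_smul, rankOneMap_self φ hr1]
    · simp [spinJ_unit]
    · simp [spinJ_unit]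
    · have : unit - r ≤ (0 : GenSpinFactor X) := by simpa using hpq
      exact absurd (le_antisymm this p0) hr1.compl.ne_zero

/-- The standard compression base of a spin factor. -/
noncomputable def spinBase : CompressionBase (GenSpinFactor X) where
  P := spinProj X
  J := spinJ φ
  isCompression _ hp := isCompression_spinJ φ hp
  unit_mem := Or.inr (Or.inl rfl)
  compl_mem _ hp := compl_mem_spinProj hp
  add_mem _ hp _ hq h := add_mem_spinProj hp hq h
  normal _ hd _ he _ hf h h1 h2 := spinProj_normal φ hd.1 he.1 hf.1 h h1 h2
  comp _ hp _ hq _ hr h := spinJ_comp φ hp hq hr h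

/-- A nonzero effect below a rank one element is a multiple of it, so at most one such element lies
above; it is the cover if it exists. -/
theorem spinBase_hasProjectionCover : (spinBase φ).HasProjectionCover := by
  intro e he
  by_cases h : ∃ q : GenSpinFactor X, IsRankOne q ∧ e ≤ q ∧ e ≠ 0
  · obtain ⟨q, hq, heq, he0⟩ := h
    refine ⟨q, Or.inr (Or.inr hq), fun r hr => ⟨fun her => ?_, heq.trans⟩⟩
    rcases hr with rfl | rfl | hr
    · exact absurd (le_antisymm her he.1) he0
    · exact hq.le_unit
    · have h1 := φ.eq_smul_of_le hq he.1 heq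
      have h2 := φ.eq_smul_of_le hr he.1 her
      have h3 : 2 * e.1 ≠ 0 := fun h3 => he0 (by rw [h1, h3, zero_smul])
      exact (smul_right_injective _ h3 (h1.symm.trans h2)).le
  by_cases he0 : e = 0
  · refine ⟨0, Or.inl rfl, fun r _ => ?_⟩
    rw [he0]
  refine ⟨unit, Or.inr (Or.inl rfl), fun r hr => ⟨fun her => ?_, he.2.trans⟩⟩
  rcases hr with rfl | rfl | hr
  · exact absurd (le_antisymm her he.1) he0
  · exact le_rfl
  · exact absurd ⟨r, hr, her, he0⟩ h

theorem spinBase_commutes_zero (a : GenSpinFactor X) : (spinBase φ).Commutes a 0 := by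
  simp [CompressionBase.Commutes, CompressionBase.J_zero, CompressionBase.J_unit]

theorem spinBase_commutes_unit (a : GenSpinFactor X) : (spinBase φ).Commutes a unit := by
  simp [CompressionBase.Commutes, CompressionBase.J_zero, CompressionBase.J_unit]

/-- As ‖p.2‖² = 1/4, the map z ↦ 4⟨p.2, z⟩ p.2 is the orthogonal projection onto ℝ p.2; commuting
with p means that a.2 lies on this line. -/
theorem spinBase_commutes_iff {p : GenSpinFactor X} (hp : IsRankOne p) (a : GenSpinFactor X) :
    (spinBase φ).Commutes a p ↔ a.2 = (4 * φ.form p.2 a.2) • p.2 := by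
  have e1 : (spinBase φ).J p = rankOneMap φ p := spinJ_of_isRankOne φ hp
  have e2 : (spinBase φ).J (unit - p) = rankOneMap φ (unit - p) := spinJ_of_isRankOne φ hp.compl
  rw [CompressionBase.Commutes, e1, e2, ext_iff']
  simp only [rankOneMap_apply, add_fst, add_snd, smul_fst, smul_snd, sub_fst, sub_snd, unit_fst,
    unit_snd, zero_sub, map_neg, LinearMap.neg_apply, hp.1]
  have h1 : (a.1 + 2 * φ.form p.2 a.2) • p.2 + (a.1 + 2 * -φ.form p.2 a.2) • -p.2 =
      (4 * φ.form p.2 a.2) • p.2 := by module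
  rw [h1]
  exact ⟨And.right, fun h => ⟨by ring, h⟩⟩

theorem spinBase_hasComparability : (spinBase φ).HasComparability := by
  intro a
  rcases le_or_gt ‖a.2‖ a.1 with h1 | h1
  · refine ⟨unit, ⟨(spinBase φ).unit_mem, fun b _ => spinBase_commutes_unit φ b⟩, ?_, ?_⟩
    · simp [CompressionBase.J_zero]
    · simpa [CompressionBase.J_unit] using (nonneg_iff a).2 h1
  rcases le_or_gt ‖a.2‖ (-a.1) with h2 | h2
  · refine ⟨0, ⟨(spinBase φ).zero_mem, fun b _ => spinBase_commutes_zero φ b⟩, ?_, ?_⟩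
    · rw [sub_zero, CompressionBase.J_unit, LinearMap.id_apply, ← neg_nonneg, nonneg_iff]
      simpa using h2
    · simp [CompressionBase.J_zero]
  have hn : 0 < ‖a.2‖ := by
    by_contra! hc
    linarith
  -- Spectral projection of a: its two parts are (a.1 + ‖a.2‖) p and (a.1 - ‖a.2‖)(1 - p), of
  -- opposite signs here.
  set p : GenSpinFactor X := mk (1 / 2) ((1 / (2 * ‖a.2‖)) • a.2) with hp
  have hp1 : IsRankOne p := by
    refine ⟨rfl, ?_⟩
    simp [hp, norm_smul]
    field_simp
  have hpa : φ.form p.2 a.2 = ‖a.2‖ / 2 := by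
    simp [hp, φ.self]
    field_simp
  have hap : a.2 = (2 * ‖a.2‖) • p.2 := by
    rw [hp, mk_snd, smul_smul, mul_one_div_cancel (by positivity), one_smul]
  refine ⟨p, ⟨Or.inr (Or.inr hp1), ?_⟩, ?_, ?_⟩
  · have hcomm : (spinBase φ).Commutes a p := by
      rw [spinBase_commutes_iff φ hp1, hpa, show 4 * (‖a.2‖ / 2) = 2 * ‖a.2‖ by ring]
      exact hap
    rintro b (⟨hb, hba⟩ | rfl)
    · rw [spinBase_commutes_iff φ hp1]
      rcases hb with rfl | rfl | hb
      · simp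
      · simp
      · have h3 := (spinBase_commutes_iff φ hb a).1 (hba a rfl)
        set s := 4 * φ.form b.2 a.2
        have h4 : |s| = 2 * ‖a.2‖ := by
          have := congrArg norm h3
          rw [norm_smul, hb.2, Real.norm_eq_abs] at this
          linarith
        have h5 : p.2 = (1 / (2 * ‖a.2‖) * s) • b.2 := by
          rw [hp, mk_snd, mul_smul, ← h3]
        set t := 1 / (2 * ‖a.2‖) * s with ht
        have h6 : t ^ 2 = 1 := by
          rw [ht, mul_pow, ← sq_abs s, h4]
          field_simp
        rw [h5]
        simp only [map_smul, LinearMap.smul_apply, φ.self, hb.2, smul_smul, smul_eq_mul]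
        rw [show 4 * (t * (1 / 2) ^ 2) * t = t ^ 2 by ring, h6, one_smul]
    · exact hcomm
  · have e2 : (spinBase φ).J (unit - p) = rankOneMap φ (unit - p) :=
      spinJ_of_isRankOne φ hp1.compl
    rw [e2, rankOneMap_apply, ← neg_nonneg, ← neg_smul]
    refine smul_nonneg' _ _ ?_ hp1.compl.nonneg
    rw [sub_snd, unit_snd, zero_sub, map_neg, LinearMap.neg_apply, hpa]
    linarith
  · have e1 : (spinBase φ).J p = rankOneMap φ p := spinJ_of_isRankOne φ hp1
    rw [e1, rankOneMap_apply, hpa]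
    exact smul_nonneg' _ _ (by linarith) hp1.nonneg

/-! ### The JBW-algebra structure of a spin factor -/

/-- The Jordan product of a spin factor. -/
noncomputable def jordanMul : GenSpinFactor X →ₗ[ℝ] GenSpinFactor X →ₗ[ℝ] GenSpinFactor X :=
  LinearMap.mk₂ ℝ (fun a b => mk (a.1 * b.1 + φ.form a.2 b.2) (a.1 • b.2 + b.1 • a.2))
    (fun a b c => ext' (by simp; ring) (by simp; module))
    (fun r a b => ext' (by simp; ring) (by simp; module))
    (fun a b c => ext' (by simp; ring) (by simp; module))
    (fun r a b => ext' (by simp; ring) (by simp; module))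

@[simp] theorem jordanMul_fst (a b : GenSpinFactor X) :
    (jordanMul φ a b).1 = a.1 * b.1 + φ.form a.2 b.2 := rfl

@[simp] theorem jordanMul_snd (a b : GenSpinFactor X) :
    (jordanMul φ a b).2 = a.1 • b.2 + b.1 • a.2 := rfl

theorem isJBProduct_jordanMul : IsJBProduct (unit : GenSpinFactor X) (jordanMul φ) where
  comm a b := ext' (by simp [φ.symm a.2, mul_comm]) (by simp [add_comm])
  jordan a b := by
    refine ext' ?_ ?_
    · simp [φ.symm b.2 a.2]
      ring
    · simp [φ.symm b.2 a.2]
      module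
  one_mul a := ext' (by simp) (by simp)
  norm_mul_le a b := by
    rw [norm_def, norm_def, norm_def, jordanMul_fst, jordanMul_snd]
    have h1 := abs_add_le (a.1 * b.1) (φ.form a.2 b.2)
    have h2 := φ.abs_form_le a.2 b.2
    have h3 := norm_add_le (a.1 • b.2) (b.1 • a.2)
    rw [abs_mul] at h1
    rw [norm_smul, norm_smul, Real.norm_eq_abs, Real.norm_eq_abs] at h3
    linarith
  norm_sq a := by
    rw [norm_def, norm_def, jordanMul_fst, jordanMul_snd, φ.self, ← two_smul ℝ (a.1 • a.2),
      norm_smul, norm_smul, abs_of_nonneg (add_nonneg (mul_self_nonneg _) (sq_nonneg _)),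
      Real.norm_ofNat, Real.norm_eq_abs]
    linear_combination -abs_mul_abs_self a.1
  norm_sq_le a b := by
    rw [norm_def, norm_def, add_fst, add_snd, jordanMul_fst, jordanMul_snd, jordanMul_fst,
      jordanMul_snd, φ.self, φ.self, ← two_smul ℝ (a.1 • a.2), ← two_smul ℝ (b.1 • b.2),
      abs_of_nonneg (add_nonneg (mul_self_nonneg _) (sq_nonneg _)),
      abs_of_nonneg (add_nonneg (add_nonneg (mul_self_nonneg _) (sq_nonneg _))
        (add_nonneg (mul_self_nonneg _) (sq_nonneg _)))]
    -- Cancellation in the vector part costs at most 2|b.1|‖b.2‖, which b.1² + ‖b.2‖² absorbs.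
    have h1 := norm_le_norm_add_norm_sub' ((2 : ℝ) • a.1 • a.2) (-((2 : ℝ) • b.1 • b.2))
    rw [sub_neg_eq_add, norm_neg, norm_smul 2 (b.1 • b.2), norm_smul b.1,
      Real.norm_ofNat, Real.norm_eq_abs] at h1
    nlinarith [sq_nonneg (|b.1| - ‖b.2‖), abs_mul_abs_self b.1]

/-- The pairing of `ℝ × X*` with `ℝ × X`. -/
noncomputable def pairing : GenSpinFactor X →ₗ[ℝ] StrongDual ℝ (ℝ × X) where
  toFun a := a.1 • ContinuousLinearMap.fst ℝ ℝ X + a.2.comp (ContinuousLinearMap.snd ℝ ℝ X)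
  map_add' a b := by
    ext x <;> simp
  map_smul' r a := by
    ext x <;> simp

theorem pairing_apply (a : GenSpinFactor X) (x : ℝ × X) : pairing a x = a.1 * x.1 + a.2 x.2 :=
  rfl

theorem norm_pairing (a : GenSpinFactor X) : ‖pairing a‖ = ‖a‖ := by
  rw [norm_def]
  apply le_antisymm
  · refine ContinuousLinearMap.opNorm_le_bound _ (by positivity) fun x => ?_
    rw [pairing_apply, add_mul]
    refine (norm_add_le _ _).trans (add_le_add ?_ ?_)
    · rw [norm_mul]
      exact mul_le_mul_of_nonneg_left (norm_fst_le x) (norm_nonneg _)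
    · exact (a.2.le_opNorm _).trans
        (mul_le_mul_of_nonneg_left (norm_snd_le x) (norm_nonneg _))
  -- Testing on (s, x), with s a sign of a.1, has supremum norm at most one and lets both
  -- coordinates be optimised independently.
  · have key : ∀ x : X, ‖x‖ ≤ 1 → |a.1| + a.2 x ≤ ‖pairing a‖ := by
      intro x hx
      obtain ⟨s, hs, hs'⟩ : ∃ s : ℝ, |s| ≤ 1 ∧ a.1 * s = |a.1| := by
        rcases abs_cases a.1 with h | h
        · exact ⟨1, by simp, by rw [h.1, mul_one]⟩
        · exact ⟨-1, by simp, by rw [h.1, mul_neg_one]⟩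
      rw [← hs']
      refine (le_abs_self _).trans (((pairing a).le_opNorm (s, x)).trans ?_)
      exact mul_le_of_le_one_right (norm_nonneg _) (max_le hs hx)
    have h0 : |a.1| ≤ ‖pairing a‖ := by simpa using key 0 (by simp)
    rw [add_comm, ← le_sub_iff_add_le]
    refine ContinuousLinearMap.opNorm_le_of_unit_norm (sub_nonneg.2 h0) fun x hx => ?_
    have h1 := key x hx.le
    have h2 := key (-x) (by rw [norm_neg, hx])
    rw [map_neg] at h2
    exact abs_le.2 ⟨by linarith, by linarith⟩

/-- A generalized spin factor is the dual of `ℝ × X` with the supremum norm. -/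
noncomputable def dualEquiv : GenSpinFactor X ≃ₗᵢ[ℝ] StrongDual ℝ (ℝ × X) :=
  LinearIsometryEquiv.ofSurjective ⟨pairing, norm_pairing⟩ fun F =>
    ⟨mk (F (1, 0)) (F.comp (ContinuousLinearMap.inr ℝ ℝ X)), by
      refine ContinuousLinearMap.ext fun x => ?_
      have := map_add F (x.1 • ((1 : ℝ), (0 : X))) (0, x.2)
      rw [map_smul] at this
      simp only [Prod.smul_mk, Prod.mk_add_mk, smul_eq_mul, mul_one, smul_zero, add_zero, zero_add,
        Prod.mk.eta] at this
      rw [this, LinearIsometry.coe_mk, pairing_apply, mk_fst, mul_comm]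
      rfl⟩

instance : CompleteSpace (GenSpinFactor X) :=
  (dualEquiv (X := X)).toIsometryEquiv.completeSpace

end GenSpinFactor

open GenSpinFactor in
theorem theorem5p4 (X : Type u) [NormedAddCommGroup X] [NormedSpace ℝ X] [CompleteSpace X] :
    List.TFAE [
      ∃ B : OrderUnitSpace.CompressionBase (GenSpinFactor X), B.IsSpectral ∧ B.JBCondition,
      (∃ B : OrderUnitSpace.CompressionBase (GenSpinFactor X), B.IsSpectral) ∧
        ∀ B : OrderUnitSpace.CompressionBase (GenSpinFactor X), B.IsSpectral → B.JBCondition,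
      IsJBAlgebra (GenSpinFactor X) OrderUnitSpace.unit,
      IsSpinFactor X,
      IsJBWAlgebra (GenSpinFactor X) OrderUnitSpace.unit] := by
  tfae_have 2 → 1 := fun ⟨⟨B, hB⟩, h⟩ => ⟨B, hB, h B hB⟩
  tfae_have 1 → 4 := fun ⟨_, hB, hJB⟩ =>
    isSpinFactor_of_dual_parallelogram (dual_parallelogram_of_jbCondition hB hJB)
  tfae_have 3 → 4 := fun ⟨_, _, h⟩ =>
    isSpinFactor_of_dual_parallelogram (dual_parallelogram_of_isJBProduct h)
  tfae_have 4 → 2 := fun h => by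
    obtain ⟨φ⟩ := h.nonempty_dualInner
    exact ⟨⟨spinBase φ, spinBase_hasProjectionCover φ, spinBase_hasComparability φ⟩,
      fun _ hB => jbCondition_of_hasComparability φ hB.2⟩
  tfae_have 4 → 5 := fun h => by
    obtain ⟨φ⟩ := h.nonempty_dualInner
    exact ⟨⟨inferInstance, jordanMul φ, isJBProduct_jordanMul φ⟩,
      ℝ × X, inferInstance, inferInstance, inferInstance, ⟨dualEquiv⟩⟩
  tfae_have 5 → 3 := fun h => h.1
  tfae_finish
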